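/- Let $k$ be a field, let $m\ge 2$, let $\mathcal G=(x_{i,j})_{1\le i,j\le m}$ be the generic $m\times m$ matrix, whose entries are independent variables over $k$, let $R=k[x_{i,j}\mid 1\le i,j\le m]$, and let $\mathcal P=I_{m-1}(\mathcal G)\subset R$ be the ideal generated by the submaximal minors of $\mathcal G$, i.e. the determinants of its $(m-1)\times(m-1)$ submatrices. The main anti-diagonal of the minor with rows $i_1<\cdots<i_{m-1}$ and columns $j_1<\cdots<j_{m-1}$ consists of the entries $x_{i_p,\,j_{m-p}}$, $1\le p\le m-1$. Let $\mathcal X$ be the set of those entries of $\mathcal G$ that lie on the main anti-diagonal of no submaximal minor. Then $\mathcal X$ has exactly $(m-1)(m-2)$ elements, and these elements, in any order, form a regular sequence on $R/\mathcal P$: for every ordering $a_1,\ldots,a_N$ of $\mathcal X$, with $N=(m-1)(m-2)$, each $a_{i}$ is a non-zero-divisor on $R/(\mathcal P,a_1,\ldots,a_{i-1})$, and $R/(\mathcal P,a_1,\ldots,a_N)\neq 0$. -/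

import Mathlib

/-- The ideal `I_r(M)` generated by the `r`-minors of the matrix `M`. A minor is given by a choice
of `r` rows and `r` columns, both listed in increasing order. -/
def minorsIdeal {R : Type*} [CommRing R] {m n : ℕ} (r : ℕ) (M : Matrix (Fin m) (Fin n) R) :
    Ideal R :=
  Ideal.span {d | ∃ (f : Fin r ↪o Fin m) (g : Fin r ↪o Fin n), d = (M.submatrix f g).det}

/-- The positions on the main anti-diagonal (from the upper right to the lower left corner) of the
square submatrix with rows `f 0 < f 1 < ⋯` and columns `g 0 < g 1 < ⋯`. -/
def mainAntidiagonal {m n r : ℕ} (f : Fin r ↪o Fin m) (g : Fin r ↪o Fin n) :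
    Set (Fin m × Fin n) :=
  {e | ∃ p : Fin r, e = (f p, g p.rev)}

/-- The positions of an `m × m` matrix that lie on the main anti-diagonal of no submaximal
(that is, `(m - 1) × (m - 1)`) minor. -/
def offAntidiagonals (m : ℕ) : Set (Fin m × Fin m) :=
  {e | ∀ f g : Fin (m - 1) ↪o Fin m, e ∉ mainAntidiagonal f g}

/-! The monomials divisible by no main anti-diagonal term of a submaximal minor form a `K`-basis of
`R/P`: the minors behave as a Gröbner basis with anti-diagonal leading terms. Multiplication by a
variable off all these anti-diagonals maps the basis into itself. Hence killing such variables kills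
exactly the basis monomials containing one of them, and the next variable stays a non-zero-divisor
(`isRegular_map_X`).

Reversing the columns reduces the basis claim to main diagonals. For spanning
(`monomial_mem_minorsIdeal_sup`), the weight `(i - j)²` is least on the diagonal term of a minor, so
rewriting diagonal terms raises the weight in a fixed degree and must stop.

For independence (`eq_zero_of_mem_minorsIdeal_of_diagFree`), let `b₀` have least weight `W` in a
diagonal-free `G ∈ P`. It avoids the four positions of some `bandCover`. There is a matrix of power
series `t ^ (i - j)² * y` with generic leading coefficients off these positions and all submaximal
minors divisible by `t ^ (W + 1)` (`exists_lift_bandCover`): four minors are handled by successive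
approximation, the others follow because these four border a unit minor. Substituting makes `G`
vanish modulo `t ^ (W + 1)`, although `b₀` survives in the coefficient of `t ^ W`. -/

open MvPolynomial

/-! ### Weights and spanning by diagonal-free monomials -/

/-- The weight `(i - j)²` of the position `(i, j)`. -/
def diagWeight {m : ℕ} (e : Fin m × Fin m) : ℕ := ((e.1 : ℤ) - (e.2 : ℤ)).natAbs ^ 2

lemma diagWeight_cast {m : ℕ} (e : Fin m × Fin m) :
    (diagWeight e : ℤ) = ((e.1 : ℤ) - (e.2 : ℤ)) ^ 2 := by
  simp [diagWeight]

lemma diagWeight_le {m : ℕ} (e : Fin m × Fin m) : diagWeight e ≤ m ^ 2 := by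
  unfold diagWeight
  have h1 := e.1.isLt
  have h2 := e.2.isLt
  exact Nat.pow_le_pow_left (by omega) 2

/-- Among the terms of a minor, the diagonal one has strictly least weight. -/
lemma sum_diagWeight_lt {m r : ℕ} (f g : Fin r ↪o Fin m) {σ : Equiv.Perm (Fin r)} (hσ : σ ≠ 1) :
    ∑ p, diagWeight (f p, g p) < ∑ p, diagWeight (f (σ p), g p) := by
  -- The squares in `(i - j)²` sum to the same value for every `σ`, so only the cross terms matter.
  -- The rearrangement inequality compares them; it is strict because a monotone permutation is the
  -- identity.
  have hmono : Monovary (fun p => ((f p : ℕ) : ℤ)) (fun p => ((g p : ℕ) : ℤ)) := by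
    intro a b h
    have h' : g a < g b := by simpa using h
    have h2 : a < b := g.lt_iff_lt.mp h'
    have h3 : f a ≤ f b := f.le_iff_le.mpr h2.le
    simpa using h3
  have hlt := (hmono.sum_comp_perm_mul_lt_sum_mul_iff (σ := σ)).mpr (by
    intro h
    apply hσ
    refine (Equiv.Perm.monotone_iff σ).mp ?_
    intro a b hab
    rcases hab.eq_or_lt with rfl | hab
    · exact le_rfl
    · have : ((f (σ a) : ℕ) : ℤ) ≤ ((f (σ b) : ℕ) : ℤ) :=
        h (show ((g a : ℕ) : ℤ) < ((g b : ℕ) : ℤ) by simpa using hab)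
      simpa using this)
  have hsq : ∑ p, ((f (σ p) : ℕ) : ℤ) ^ 2 = ∑ p, ((f p : ℕ) : ℤ) ^ 2 :=
    Equiv.sum_comp σ fun p => ((f p : ℕ) : ℤ) ^ 2
  zify
  simp only [diagWeight_cast, sub_sq, Finset.sum_add_distrib, Finset.sum_sub_distrib, hsq,
    mul_assoc, ← Finset.mul_sum]
  linarith

/-- Exponents of monomials divisible by the diagonal term of no `r`-minor. -/
def diagFree (m r : ℕ) : Set (Fin m × Fin m →₀ ℕ) :=
  {b | ∀ f g : Fin r ↪o Fin m, ∃ p, b (f p, g p) = 0}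

lemma det_submatrix_eq_diag_add {m r : ℕ} {S : Type*} [CommRing S] (M : Matrix (Fin m) (Fin m) S)
    (f g : Fin r → Fin m) :
    (M.submatrix f g).det = ∏ p, M (f p) (g p) +
      ∑ σ ∈ Finset.univ.erase (1 : Equiv.Perm (Fin r)),
        (Equiv.Perm.sign σ : ℤ) * ∏ p, M (f (σ p)) (g p) := by
  rw [Matrix.det_apply', ← Finset.add_sum_erase _ _ (Finset.mem_univ 1)]
  simp

lemma monomial_add_sum_single {τ ι K : Type*} [CommSemiring K] (s : Finset ι) (b : τ →₀ ℕ)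
    (e : ι → τ) :
    monomial (b + ∑ p ∈ s, Finsupp.single (e p) 1) (1 : K) = monomial b 1 * ∏ p ∈ s, X (e p) := by
  classical
  induction s using Finset.induction_on with
  | empty => simp
  | insert a s ha ih =>
    rw [Finset.sum_insert ha, Finset.prod_insert ha, mul_left_comm, ← ih, X, monomial_mul, one_mul,
      add_left_comm]

lemma weight_diagWeight_le {m : ℕ} (b : Fin m × Fin m →₀ ℕ) :
    Finsupp.weight diagWeight b ≤ b.degree * m ^ 2 := by
  rw [Finsupp.weight_apply, Finsupp.degree_apply, Finset.sum_mul, Finsupp.sum]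
  exact Finset.sum_le_sum fun e _ => Nat.mul_le_mul_left _ (diagWeight_le e)

/-- Modulo the `r`-minors, every monomial is a combination of diagonal-free ones. -/
lemma monomial_mem_minorsIdeal_sup (K : Type*) [Field K] (m r : ℕ) (b : Fin m × Fin m →₀ ℕ) :
    monomial b (1 : K) ∈
      (minorsIdeal r (Matrix.mvPolynomialX (Fin m) (Fin m) K)).restrictScalars K ⊔
        restrictSupport K (diagFree m r) := by
  -- Rewriting keeps the degree, hence the upper bound `b.degree * m ^ 2`, and strictly raises the
  -- weight.
  induction hk : b.degree * m ^ 2 - Finsupp.weight diagWeight b using Nat.strong_induction_on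
    generalizing b with
  | _ k ih =>
  by_cases hb : b ∈ diagFree m r
  · exact Submodule.mem_sup_right ((monomial_mem_restrictSupport ..).mpr (Or.inl hb))
  · simp only [diagFree, Set.mem_ofPred_eq, not_forall, not_exists] at hb
    obtain ⟨f, g, hfg⟩ := hb
    let D : Equiv.Perm (Fin r) → (Fin m × Fin m →₀ ℕ) := fun σ =>
      ∑ p, Finsupp.single (f (σ p), g p) 1
    have hD : D 1 ≤ b := by
      intro e
      by_cases he : ∃ p, e = (f p, g p)
      · obtain ⟨p, rfl⟩ := he
        have : D 1 (f p, g p) = 1 := by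
          simp only [D, Finsupp.finsetSum_apply, Finsupp.single_apply, Prod.mk.injEq,
            EmbeddingLike.apply_eq_iff_eq, Equiv.Perm.one_apply, and_self]
          simp
        rw [this]
        exact Nat.one_le_iff_ne_zero.mpr (hfg p)
      · have : D 1 e = 0 := by
          simp only [D, Finsupp.finsetSum_apply]
          refine Finset.sum_eq_zero fun p _ => Finsupp.single_eq_of_ne ?_
          intro h
          exact he ⟨p, h⟩
        rw [this]
        exact Nat.zero_le _
    obtain ⟨c, rfl⟩ := exists_add_of_le hD
    rw [add_comm (D 1) c] at hk ⊢
    have hw (σ) : Finsupp.weight diagWeight (D σ) = ∑ p, diagWeight (f (σ p), g p) := by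
      simp [D, Finsupp.weight_single]
    have hdeg (σ) : (D σ).degree = r := by
      simp [D]
    have key : monomial (c + D 1) (1 : K) =
        monomial c 1 * ((Matrix.mvPolynomialX (Fin m) (Fin m) K).submatrix f g).det -
        ∑ σ ∈ Finset.univ.erase (1 : Equiv.Perm (Fin r)),
          ((Equiv.Perm.sign σ : ℤ) : K) • monomial (c + D σ) 1 := by
      rw [det_submatrix_eq_diag_add, mul_add, Finset.mul_sum]
      simp only [D, monomial_add_sum_single, Matrix.mvPolynomialX_apply, Equiv.Perm.one_apply,
        smul_eq_C_mul]
      rw [eq_sub_iff_add_eq, add_right_inj]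
      refine Finset.sum_congr rfl fun σ _ => ?_
      rw [map_intCast, mul_left_comm]
    rw [key]
    refine Submodule.sub_mem _ (Submodule.mem_sup_left ?_) (Submodule.sum_mem _ fun σ hσ => ?_)
    · exact Ideal.mul_mem_left _ _ (Ideal.subset_span ⟨f, g, rfl⟩)
    · refine Submodule.smul_mem _ _ (ih _ ?_ _ rfl)
      have h1 := sum_diagWeight_lt f g (Finset.ne_of_mem_erase hσ)
      have h2 := weight_diagWeight_le (c + D σ)
      rw [← hk]
      simp only [map_add, hw, hdeg] at h2 ⊢
      simp only [Equiv.Perm.one_apply]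
      omega

/-- Modulo the `r`-minors, every polynomial is a combination of diagonal-free monomials. -/
lemma exists_restrictSupport_diagFree (K : Type*) [Field K] (m r : ℕ)
    (F : MvPolynomial (Fin m × Fin m) K) :
    ∃ G ∈ restrictSupport K (diagFree m r),
      F - G ∈ minorsIdeal r (Matrix.mvPolynomialX (Fin m) (Fin m) K) := by
  have hF : F ∈ (minorsIdeal r (Matrix.mvPolynomialX (Fin m) (Fin m) K)).restrictScalars K ⊔
      restrictSupport K (diagFree m r) := by
    rw [F.as_sum]
    refine Submodule.sum_mem _ fun b _ => ?_
    rw [← mul_one (coeff b F), ← smul_eq_mul, ← smul_monomial]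
    exact Submodule.smul_mem _ _ (monomial_mem_minorsIdeal_sup K m r b)
  obtain ⟨H, hH, G, hG, rfl⟩ := Submodule.mem_sup.mp hF
  exact ⟨G, hG, by simpa using hH⟩

/-! ### Lifting to power series by successive approximation -/

/-- The matrix with entries `t ^ (i - j)² * y (i, j)`. -/
def weightedMatrix {m : ℕ} {S : Type*} [CommRing S] (t : S) (y : Fin m × Fin m → S) :
    Matrix (Fin m) (Fin m) S :=
  Matrix.of fun i j => t ^ diagWeight (i, j) * y (i, j)

/-- The contribution of the non-diagonal terms to a minor of `weightedMatrix t y`, divided by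
`t * t ^ w` for `w` the weight of the diagonal term. -/
def minorTail {m r : ℕ} {S : Type*} [CommRing S] (t : S) (f g : Fin r ↪o Fin m)
    (y : Fin m × Fin m → S) : S :=
  ∑ σ ∈ Finset.univ.erase (1 : Equiv.Perm (Fin r)), ((Equiv.Perm.sign σ : ℤ) : S) *
    (t ^ (∑ p, diagWeight (f (σ p), g p) - ∑ p, diagWeight (f p, g p) - 1) *
      ∏ p, y (f (σ p), g p))

lemma det_submatrix_weightedMatrix {m r : ℕ} {S : Type*} [CommRing S] (t : S)
    (f g : Fin r ↪o Fin m) (y : Fin m × Fin m → S) :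
    ((weightedMatrix t y).submatrix f g).det =
      t ^ (∑ p, diagWeight (f p, g p)) * (∏ p, y (f p, g p) + t * minorTail t f g y) := by
  rw [det_submatrix_eq_diag_add, mul_add]
  simp only [weightedMatrix, Matrix.of_apply, Finset.prod_mul_distrib, Finset.prod_pow_eq_pow_sum,
    minorTail, Finset.mul_sum]
  rw [add_right_inj]
  refine Finset.sum_congr rfl fun σ hσ => ?_
  -- Strictness makes both truncated subtractions in the exponent exact.
  have h := sum_diagWeight_lt f g (Finset.ne_of_mem_erase hσ)
  obtain ⟨d, hd⟩ := Nat.exists_eq_add_of_lt h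
  rw [hd, show ∑ p, diagWeight (f p, g p) + d + 1 - ∑ p, diagWeight (f p, g p) - 1 = d by omega]
  ring

lemma dvd_minorTail_sub {m r : ℕ} {S : Type*} [CommRing S] (t c : S) (f g : Fin r ↪o Fin m)
    {y y' : Fin m × Fin m → S} (h : ∀ e, c ∣ y' e - y e) :
    c ∣ minorTail t f g y' - minorTail t f g y := by
  rw [← Ideal.mem_span_singleton, ← Ideal.Quotient.eq]
  have h' (e) : Ideal.Quotient.mk (Ideal.span {c}) (y' e) =
      Ideal.Quotient.mk (Ideal.span {c}) (y e) := by
    rw [Ideal.Quotient.eq, Ideal.mem_span_singleton]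
    exact h e
  simp only [minorTail, map_sum, map_mul, map_prod, h']

open PowerSeries in
/-- Given minors whose diagonals each contain exactly one of certain distinct positions, the entries
at these positions can be chosen in `X * A⟦X⟧` so that the minors of the weighted matrix become
divisible by any given power of `X`. -/
lemma exists_lift_of_minors {A ι : Type*} [Field A] {m r : ℕ} (f g : ι → (Fin r ↪o Fin m))
    (p : ι → Fin r) (hinj : Function.Injective fun s => (f s (p s), g s (p s)))
    (huniq : ∀ s s' q, (f s q, g s q) = (f s' (p s'), g s' (p s')) → q = p s)
    (y₀ : Fin m × Fin m → A) (hy₀ : ∀ e, y₀ e ≠ 0) (N : ℕ) :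
    ∃ y : Fin m × Fin m → PowerSeries A,
      (∀ e, (∀ s, e ≠ (f s (p s), g s (p s))) → y e = PowerSeries.C (y₀ e)) ∧
      (∀ s, constantCoeff (y (f s (p s), g s (p s))) = 0) ∧
      ∀ s, (PowerSeries.X : PowerSeries A) ^ N ∣
        ((weightedMatrix PowerSeries.X y).submatrix (f s) (g s)).det := by
  classical
  suffices h : ∃ y : Fin m × Fin m → PowerSeries A,
      (∀ e, (∀ s, e ≠ (f s (p s), g s (p s))) → y e = PowerSeries.C (y₀ e)) ∧
      (∀ s, constantCoeff (y (f s (p s), g s (p s))) = 0) ∧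
      ∀ s, (PowerSeries.X : PowerSeries A) ^ N ∣
        ∏ q, y (f s q, g s q) + PowerSeries.X * minorTail PowerSeries.X (f s) (g s) y by
    obtain ⟨y, h1, h2, h3⟩ := h
    refine ⟨y, h1, h2, fun s => ?_⟩
    rw [det_submatrix_weightedMatrix]
    exact (h3 s).mul_left _
  have hoff (s : ι) (q : Fin r) (hq : q ≠ p s) (s') :
      (f s q, g s q) ≠ (f s' (p s'), g s' (p s')) := fun h => hq (huniq s s' q h)
  induction N with
  | zero =>
    refine ⟨fun e => if ∃ s, e = (f s (p s), g s (p s)) then 0 else PowerSeries.C (y₀ e),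
      fun e he => ?_, fun s => ?_, fun s => ?_⟩
    · exact if_neg fun ⟨s, hs⟩ => he s hs
    · exact (congrArg _ (if_pos ⟨s, rfl⟩)).trans (map_zero _)
    · simp
  | succ N ih =>
    obtain ⟨y, h1, h2, h3⟩ := ih
    -- By `huniq` the other diagonal entries of minor `s` are the constants `y₀`. The minor is thus
    -- linear in its special entry up to the tail, and subtracting `E s / c s` from that entry
    -- cancels the current error.
    let c : ι → A := fun s => ∏ q ∈ Finset.univ.erase (p s), y₀ (f s q, g s q)
    have hc (s) : c s ≠ 0 := Finset.prod_ne_zero_iff.mpr fun q _ => hy₀ _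
    have hprod (z : Fin m × Fin m → PowerSeries A)
        (hz : ∀ e, (∀ s, e ≠ (f s (p s), g s (p s))) → z e = PowerSeries.C (y₀ e)) (s : ι) :
        ∏ q, z (f s q, g s q) = z (f s (p s), g s (p s)) * PowerSeries.C (c s) := by
      rw [← Finset.mul_prod_erase _ _ (Finset.mem_univ (p s)), map_prod]
      refine congrArg _ (Finset.prod_congr rfl fun q hq => ?_)
      exact hz _ (hoff s q (Finset.ne_of_mem_erase hq))
    let E : ι → PowerSeries A := fun s =>
      ∏ q, y (f s q, g s q) + PowerSeries.X * minorTail PowerSeries.X (f s) (g s) y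
    have hex (e) : ∃ z : PowerSeries A,
        ((∀ s, e ≠ (f s (p s), g s (p s))) → z = y e) ∧
        ∀ s, e = (f s (p s), g s (p s)) → z = y e - PowerSeries.C (c s)⁻¹ * E s := by
      by_cases he : ∃ s, e = (f s (p s), g s (p s))
      · obtain ⟨s, hs⟩ := he
        refine ⟨y e - PowerSeries.C (c s)⁻¹ * E s, fun h => absurd hs (h s), fun s' hs' => ?_⟩
        rw [hinj (hs.symm.trans hs')]
      · exact ⟨y e, fun _ => rfl, fun s hs => absurd ⟨s, hs⟩ he⟩
    choose y' hy'off hy'on using hex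
    have hy' : ∀ e, (∀ s, e ≠ (f s (p s), g s (p s))) → y' e = PowerSeries.C (y₀ e) :=
      fun e he => (hy'off e he).trans (h1 e he)
    refine ⟨y', hy', fun s => ?_, fun s => ?_⟩
    · rw [hy'on _ s rfl]
      simp only [E, hprod y h1]
      simp [h2]
    · have hcong (e) : (PowerSeries.X : PowerSeries A) ^ N ∣ y' e - y e := by
        by_cases he : ∃ s, e = (f s (p s), g s (p s))
        · obtain ⟨s, hs⟩ := he
          rw [hy'on e s hs, sub_sub_cancel_left, dvd_neg]
          exact (h3 s).mul_left _
        · push Not at he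
          rw [hy'off e he, sub_self]
          exact dvd_zero _
      have hinv : PowerSeries.C (c s)⁻¹ * PowerSeries.C (c s) = 1 := by
        rw [← map_mul, inv_mul_cancel₀ (hc s), map_one]
      have hE : E s = y (f s (p s), g s (p s)) * PowerSeries.C (c s) +
          PowerSeries.X * minorTail PowerSeries.X (f s) (g s) y := by
        simp only [E, hprod y h1]
      -- Only the change of the tail remains. It is divisible by `X ^ N`, and the factor `X` before
      -- it gains one order.
      have : ∏ q, y' (f s q, g s q) + PowerSeries.X * minorTail PowerSeries.X (f s) (g s) y' =
          PowerSeries.X * (minorTail PowerSeries.X (f s) (g s) y' -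
            minorTail PowerSeries.X (f s) (g s) y) := by
        rw [hprod y' hy', hy'on _ s rfl]
        linear_combination -hE - E s * hinv
      rw [this, pow_succ']
      exact mul_dvd_mul_left _ (dvd_minorTail_sub _ _ _ _ hcong)

/-! ### Vanishing of minors from the bordering ones -/

namespace Matrix

lemma det_mul_eq_zero_of_card_lt {S α κ : Type*} [CommRing S] [Fintype α] [DecidableEq α]
    [Fintype κ] (h : Fintype.card κ < Fintype.card α) (U : Matrix α κ S) (V : Matrix κ α S) :
    (U * V).det = 0 := by
  -- Padding `U` with zero columns and `V` with zero rows makes both factors square.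
  obtain ⟨e⟩ : Nonempty (α ≃ κ ⊕ Fin (Fintype.card α - Fintype.card κ)) := by
    rw [← Fintype.card_eq]
    simp only [Fintype.card_sum, Fintype.card_fin]
    omega
  have hUV : U * V = (fromCols U (0 : Matrix α (Fin (Fintype.card α - Fintype.card κ)) S)).submatrix
      id e * (fromRows V (0 : Matrix (Fin (Fintype.card α - Fintype.card κ)) α S)).submatrix e id := by
    rw [submatrix_mul_equiv, fromCols_mul_fromRows]
    simp
  rw [hUV, det_mul, det_eq_zero_of_column_eq_zero
    (e.symm (Sum.inr ⟨0, Nat.sub_pos_of_lt h⟩)), zero_mul]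
  intro i
  simp

lemma det_submatrix_equiv_equiv_eq_zero_iff {S α β : Type*} [CommRing S] [Fintype α]
    [DecidableEq α] [Fintype β] [DecidableEq β] (e₁ e₂ : β ≃ α) (M : Matrix α α S) :
    (M.submatrix e₁ e₂).det = 0 ↔ M.det = 0 := by
  have h : M.submatrix e₁ e₂ = (M.submatrix id (e₁.symm.trans e₂)).submatrix e₁ e₁ := by
    ext i j
    simp
  rw [h, det_submatrix_equiv_self, det_permute']
  rcases Int.units_eq_one_or (Equiv.Perm.sign (e₁.symm.trans e₂)) with h | h <;> simp [h]

/-- If the complementary minor of the rows and columns `i, j` is a unit and the four minors that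
border it vanish, then the matrix factors through a free module of rank `m - 2`, so all
`(m - 1)`-minors vanish. -/
lemma det_submatrix_eq_zero_of_bordering {S : Type*} [CommRing S] {n : ℕ}
    (M : Matrix (Fin (n + 1)) (Fin (n + 1)) S) {i j : Fin (n + 1)} (hij : i ≠ j)
    (hunit : IsUnit (M.submatrix (Subtype.val : {p // p ≠ i ∧ p ≠ j} → _)
      (Subtype.val : {p // p ≠ i ∧ p ≠ j} → _)).det)
    (hminor : ∀ a c, (a = i ∨ a = j) → (c = i ∨ c = j) →
      (M.submatrix a.succAbove c.succAbove).det = 0) (f g : Fin n → Fin (n + 1)) :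
    (M.submatrix f g).det = 0 := by
  let T := {p : Fin (n + 1) // p ≠ i ∧ p ≠ j}
  let v : T → Fin (n + 1) := Subtype.val
  let D := M.submatrix v v
  have hcardT : Fintype.card T = n - 1 := by
    have : Fintype.card T = (Finset.univ \ {i, j} : Finset (Fin (n + 1))).card := by
      rw [Fintype.card_subtype]
      congr 1
      ext p
      simp
    rw [this, Finset.card_sdiff_of_subset (Finset.subset_univ _), Finset.card_pair hij]
    simp
  have hn : 0 < n := by
    rcases Nat.eq_zero_or_pos n with rfl | h
    · exact absurd (Fin.ext (by omega)) hij
    · exact h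
  let _ : Invertible D := Matrix.invertibleOfIsUnitDet _ hunit
  have hother : ∀ a, (a = i ∨ a = j) → ∃ b, (b = i ∨ b = j) ∧ b ≠ a := by
    rintro a (rfl | rfl)
    · exact ⟨j, Or.inr rfl, hij.symm⟩
    · exact ⟨i, Or.inl rfl, hij⟩
  -- Listing the rows (or columns) different from `b` with `a` last.
  have hequiv : ∀ a b, (a = i ∨ a = j) → (b = i ∨ b = j) → b ≠ a →
      ∃ e : T ⊕ Unit ≃ Fin n, ∀ s, b.succAbove (e s) = Sum.elim v (fun _ => a) s := by
    intro a b ha hb hba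
    have hne : ∀ s, Sum.elim v (fun _ : Unit => a) s ≠ b := by
      rintro (p | _)
      · rcases hb with rfl | rfl
        · exact p.2.1
        · exact p.2.2
      · exact hba.symm
    choose e he using fun s => Fin.exists_succAbove_eq (hne s)
    have hinj : Function.Injective e := by
      intro s s' hss
      have := (he s).symm.trans ((congrArg b.succAbove hss).trans (he s'))
      have hva : ∀ p : T, v p ≠ a := by
        rcases ha with rfl | rfl
        · exact fun p => p.2.1
        · exact fun p => p.2.2
      rcases s with p | u <;> rcases s' with p' | u'
      · exact congrArg Sum.inl (Subtype.ext this)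
      · exact absurd this (hva p)
      · exact absurd this.symm (hva p')
      · rfl
    refine ⟨Equiv.ofBijective e ((Fintype.bijective_iff_injective_and_card e).mpr ⟨hinj, ?_⟩), he⟩
    simp only [Fintype.card_sum, hcardT, Fintype.card_unit, Fintype.card_fin]
    omega
  -- The minor omitting the other row `a'` and the other column `c'` is `det D` times a `1 × 1`
  -- Schur complement, which must therefore vanish.
  have hcorner : ∀ a c, (a = i ∨ a = j) → (c = i ∨ c = j) →
      M a c = (M.submatrix id v * ⅟D * M.submatrix v id) a c := by
    intro a c ha hc
    obtain ⟨a', ha', haa'⟩ := hother a ha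
    obtain ⟨c', hc', hcc'⟩ := hother c hc
    obtain ⟨e₁, he₁⟩ := hequiv a a' ha ha' haa'
    obtain ⟨e₂, he₂⟩ := hequiv c c' hc hc' hcc'
    have h0 := (det_submatrix_equiv_equiv_eq_zero_iff e₁ e₂ _).mpr (hminor a' c' ha' hc')
    have hblock : (M.submatrix a'.succAbove c'.succAbove).submatrix e₁ e₂ =
        fromBlocks D (M.submatrix v fun _ : Unit => c) (M.submatrix (fun _ : Unit => a) v)
          (M.submatrix (fun _ : Unit => a) fun _ : Unit => c) := by
      ext s s'
      rw [submatrix_apply, submatrix_apply, he₁, he₂]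
      rcases s with p | u <;> rcases s' with p' | u' <;> rfl
    rw [hblock, det_fromBlocks₁₁, hunit.mul_right_eq_zero, det_unique, sub_apply, sub_eq_zero] at h0
    exact h0
  -- Outside the four corners the identity is automatic, since `⅟D` cancels against `D`.
  have hfactor : M = M.submatrix id v * (⅟D * M.submatrix v id) := by
    rw [← Matrix.mul_assoc]
    ext a c
    by_cases ha : a = i ∨ a = j
    · by_cases hc : c = i ∨ c = j
      · exact hcorner a c ha hc
      · push Not at hc
        have h : (M.submatrix id v * ⅟D * M.submatrix v id).submatrix id v = M.submatrix id v := by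
          rw [submatrix_mul _ _ id id v Function.bijective_id]
          change M.submatrix id v * ⅟D * D = _
          rw [Matrix.mul_assoc, invOf_mul_self, Matrix.mul_one]
        exact (congrFun (congrFun h a) ⟨c, hc⟩).symm
    · push Not at ha
      have h : (M.submatrix id v * ⅟D * M.submatrix v id).submatrix v id = M.submatrix v id := by
        rw [Matrix.mul_assoc, submatrix_mul _ _ v id id Function.bijective_id]
        change D * (⅟D * M.submatrix v id) = _
        rw [← Matrix.mul_assoc, mul_invOf_self, Matrix.one_mul]
      exact (congrFun (congrFun h ⟨a, ha⟩) c).symm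
  rw [hfactor, submatrix_mul _ _ f id g Function.bijective_id]
  refine det_mul_eq_zero_of_card_lt ?_ _ _
  rw [hcardT, Fintype.card_fin]
  omega

end Matrix

/-! ### Supports of diagonal-free monomials and the lift adapted to them -/

lemma Fin.val_succAbove_eq_ite {n : ℕ} (a : Fin (n + 1)) (p : Fin n) :
    (a.succAbove p : ℕ) = if (p : ℕ) < a then (p : ℕ) else p + 1 := by
  unfold Fin.succAbove
  simp only [Fin.lt_def, Fin.val_castSucc]
  split_ifs <;> simp

/-- The support of a diagonal-free monomial avoids two diagonal positions, and one subdiagonal and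
one superdiagonal position between them. -/
lemma exists_zeros_of_mem_diagFree {n : ℕ} {b : Fin (n + 1) × Fin (n + 1) →₀ ℕ}
    (hb : b ∈ diagFree (n + 1) n) :
    ∃ i j : Fin (n + 1), ∃ k l : Fin n, i ≤ k.castSucc ∧ k.succ ≤ j ∧ i ≤ l.castSucc ∧ l.succ ≤ j ∧
      b (i, i) = 0 ∧ b (j, j) = 0 ∧ b (k.succ, k.castSucc) = 0 ∧ b (l.castSucc, l.succ) = 0 := by
  classical
  have hb' (a c : Fin (n + 1)) : ∃ p : Fin n, b (a.succAbove p, c.succAbove p) = 0 :=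
    hb (Fin.succAboveOrderEmb a) (Fin.succAboveOrderEmb c)
  let Z : Finset (Fin (n + 1)) := Finset.univ.filter fun p => b (p, p) = 0
  have hZ (p) : p ∈ Z ↔ b (p, p) = 0 := by simp [Z]
  have hne : Z.Nonempty := by
    obtain ⟨p, hp⟩ := hb' 0 0
    exact ⟨_, (hZ _).mpr hp⟩
  let i := Z.min' hne
  let j := Z.max' hne
  have hi : b (i, i) = 0 := (hZ _).mp (Z.min'_mem hne)
  have hj : b (j, j) = 0 := (hZ _).mp (Z.max'_mem hne)
  have hlow (p) (hp : b (p, p) = 0) : i ≤ p := Z.min'_le _ ((hZ _).mpr hp)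
  have hupp (p) (hp : b (p, p) = 0) : p ≤ j := Z.le_max' _ ((hZ _).mpr hp)
  have hij : i < j := by
    obtain ⟨p, hp⟩ := hb' i i
    exact lt_of_lt_of_le (lt_of_le_of_ne (hlow _ hp) (Fin.succAbove_ne i p).symm) (hupp _ hp)
  have hsmall (p : Fin n) (hp : p.castSucc < i) : b (p.castSucc, p.castSucc) ≠ 0 :=
    fun h => absurd (hlow _ h) (not_le.mpr hp)
  have hbig (p : Fin n) (hp : j ≤ p.castSucc) : b (p.succ, p.succ) ≠ 0 :=
    fun h => absurd (hupp _ h) (not_le.mpr (Fin.le_castSucc_iff.mp hp))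
  -- Deleting row `i` and column `j` leaves a diagonal that is the main one before `i` and after
  -- `j`, where `b` is nonzero by extremality, and the subdiagonal in between. Exchanging `i` and
  -- `j` gives the superdiagonal.
  obtain ⟨k, hk⟩ := hb' i j
  obtain ⟨l, hl⟩ := hb' j i
  have hk1 : i ≤ k.castSucc := by
    by_contra! h
    rw [Fin.succAbove_of_castSucc_lt _ _ h, Fin.succAbove_of_castSucc_lt _ _ (h.trans hij)] at hk
    exact hsmall k h hk
  have hk2 : k.castSucc < j := by
    by_contra! h
    rw [Fin.succAbove_of_le_castSucc _ _ h, Fin.succAbove_of_le_castSucc _ _ (hij.le.trans h)] at hk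
    exact hbig k h hk
  have hl1 : i ≤ l.castSucc := by
    by_contra! h
    rw [Fin.succAbove_of_castSucc_lt _ _ h, Fin.succAbove_of_castSucc_lt _ _ (h.trans hij)] at hl
    exact hsmall l h hl
  have hl2 : l.castSucc < j := by
    by_contra! h
    rw [Fin.succAbove_of_le_castSucc _ _ h, Fin.succAbove_of_le_castSucc _ _ (hij.le.trans h)] at hl
    exact hbig l h hl
  refine ⟨i, j, k, l, hk1, Fin.castSucc_lt_iff_succ_le.mp hk2, hl1,
    Fin.castSucc_lt_iff_succ_le.mp hl2, hi, hj, ?_, ?_⟩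
  · rwa [Fin.succAbove_of_le_castSucc _ _ hk1, Fin.succAbove_of_castSucc_lt _ _ hk2] at hk
  · rwa [Fin.succAbove_of_le_castSucc _ _ hl1, Fin.succAbove_of_castSucc_lt _ _ hl2] at hl

/-- Two diagonal positions `(i, i)`, `(j, j)`, a subdiagonal and a superdiagonal position. -/
def bandCover {n : ℕ} (i j : Fin (n + 1)) (k l : Fin n) : Finset (Fin (n + 1) × Fin (n + 1)) :=
  {(i, i), (j, j), (k.succ, k.castSucc), (l.castSucc, l.succ)}

/-- A matrix with prescribed leading coefficients off `bandCover i j k l` and vanishing leading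
coefficients on it can be lifted to one all of whose submaximal minors are divisible by `X ^ N`. -/
lemma exists_lift_bandCover {A : Type*} [Field A] {n : ℕ} {i j : Fin (n + 1)} {k l : Fin n}
    (hik : i ≤ k.castSucc) (hkj : k.succ ≤ j) (hil : i ≤ l.castSucc) (hlj : l.succ ≤ j)
    (y₀ : Fin (n + 1) × Fin (n + 1) → A) (hy₀ : ∀ e, y₀ e ≠ 0) (N : ℕ) :
    ∃ y : Fin (n + 1) × Fin (n + 1) → PowerSeries A,
      (∀ e ∉ bandCover i j k l, y e = PowerSeries.C (y₀ e)) ∧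
      (∀ e ∈ bandCover i j k l, PowerSeries.constantCoeff (y e) = 0) ∧
      ∀ f g : Fin n → Fin (n + 1), (PowerSeries.X : PowerSeries A) ^ N ∣
        ((weightedMatrix PowerSeries.X y).submatrix f g).det := by
  have hij : i < j := lt_of_le_of_lt hik (Fin.castSucc_lt_iff_succ_le.mpr hkj)
  have hin : (i : ℕ) < n := by have := j.isLt; have : (i : ℕ) < j := hij; omega
  have hjn : (j : ℕ) - 1 < n := by have := j.isLt; have : (i : ℕ) < j := hij; omega
  -- The index `s` selects the deleted row and column among `i`, `j`; `e s` is the only cover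
  -- position on the diagonal of that minor, at index `p s`.
  let R : Bool → Fin (n + 1) := fun s => if s then i else j
  let p : Bool × Bool → Fin n := fun s =>
    if s.1 then (if s.2 then ⟨j - 1, hjn⟩ else k) else (if s.2 then l else ⟨i, hin⟩)
  let e : Bool × Bool → Fin (n + 1) × Fin (n + 1) := fun s =>
    if s.1 then (if s.2 then (j, j) else (k.succ, k.castSucc))
    else (if s.2 then (l.castSucc, l.succ) else (i, i))
  have hij' : (i : ℕ) < j := hij
  have hik' : (i : ℕ) ≤ k := hik
  have hkj' : (k : ℕ) + 1 ≤ j := hkj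
  have hil' : (i : ℕ) ≤ l := hil
  have hlj' : (l : ℕ) + 1 ≤ j := hlj
  have hpos (s) : ((R s.1).succAbove (p s), (R s.2).succAbove (p s)) = e s := by
    rcases s with ⟨_ | _, _ | _⟩ <;>
    · simp only [R, p, e, Prod.mk.injEq, Fin.ext_iff, Fin.val_succAbove_eq_ite, Bool.false_eq_true,
        if_true, if_false, Fin.val_succ, Fin.val_castSucc]
      constructor <;> split_ifs <;> omega
  have hinj : Function.Injective e := by
    rintro ⟨_ | _, _ | _⟩ ⟨_ | _, _ | _⟩ h <;>
    simp only [e, Prod.mk.injEq, Fin.ext_iff, Bool.false_eq_true, if_true, if_false, Fin.val_succ,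
      Fin.val_castSucc] at h <;> first | rfl | omega
  have huniq (s s') (q : Fin n) (h : ((R s.1).succAbove q, (R s.2).succAbove q) = e s') :
      q = p s := by
    rcases s with ⟨_ | _, _ | _⟩ <;> rcases s' with ⟨_ | _, _ | _⟩ <;>
    · simp only [R, p, e, Prod.mk.injEq, Fin.ext_iff, Fin.val_succAbove_eq_ite, Bool.false_eq_true,
        if_true, if_false, Fin.val_succ, Fin.val_castSucc] at h ⊢
      obtain ⟨h1, h2⟩ := h
      split_ifs at h1 h2 <;> omega
  have hcover (x) : x ∈ bandCover i j k l ↔ ∃ s, x = e s := by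
    simp only [bandCover, Finset.mem_insert, Finset.mem_singleton, Prod.exists, Bool.exists_bool, e]
    simp only [Bool.false_eq_true, if_true, if_false]
    tauto
  obtain ⟨y, h1, h2, h3⟩ := exists_lift_of_minors
    (fun s : Bool × Bool => Fin.succAboveOrderEmb (R s.1))
    (fun s => Fin.succAboveOrderEmb (R s.2)) p
    (by simpa only [Fin.succAboveOrderEmb_apply, hpos] using hinj)
    (by simpa only [Fin.succAboveOrderEmb_apply, hpos] using huniq) y₀ hy₀ N
  simp only [Fin.succAboveOrderEmb_apply, hpos] at h1 h2
  refine ⟨y, fun x hx => h1 x fun s hs => hx ((hcover x).mpr ⟨s, hs⟩), fun x hx => ?_,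
    fun f g => ?_⟩
  · obtain ⟨s, rfl⟩ := (hcover x).mp hx
    exact h2 s
  · let I : Ideal (PowerSeries A) := Ideal.span {PowerSeries.X ^ N}
    have hI (x) : Ideal.Quotient.mk I x = 0 ↔ (PowerSeries.X : PowerSeries A) ^ N ∣ x := by
      rw [Ideal.Quotient.eq_zero_iff_mem, Ideal.mem_span_singleton]
    have hdet {τ : Type} [Fintype τ] [DecidableEq τ] (f g : τ → Fin (n + 1)) :
        (((weightedMatrix PowerSeries.X y).map (Ideal.Quotient.mk I)).submatrix f g).det =
          Ideal.Quotient.mk I ((weightedMatrix PowerSeries.X y).submatrix f g).det := by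
      rw [RingHom.map_det, RingHom.mapMatrix_apply, Matrix.submatrix_map]
    rw [← hI, ← hdet]
    refine Matrix.det_submatrix_eq_zero_of_bordering _ hij.ne ?_ ?_ f g
    · rw [hdet]
      refine IsUnit.map _ ?_
      rw [PowerSeries.isUnit_iff_constantCoeff, RingHom.map_det, isUnit_iff_ne_zero]
      -- Off-diagonal entries have positive weight, so at `X = 0` the central submatrix is diagonal
      -- with nonzero entries.
      have hdiag : PowerSeries.constantCoeff.mapMatrix
          ((weightedMatrix PowerSeries.X y).submatrix
            (Subtype.val : {p // p ≠ i ∧ p ≠ j} → _) Subtype.val) =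
          Matrix.diagonal fun p : {p // p ≠ i ∧ p ≠ j} => y₀ (p.1, p.1) := by
        ext p q
        by_cases hpq : p = q
        · subst hpq
          have hp : y (p.1, p.1) = PowerSeries.C (y₀ (p.1, p.1)) := by
            refine h1 _ fun s => ?_
            have hp1 : (p.1 : ℕ) ≠ i := fun h => p.2.1 (Fin.ext h)
            have hp2 : (p.1 : ℕ) ≠ j := fun h => p.2.2 (Fin.ext h)
            rcases s with ⟨_ | _, _ | _⟩ <;>
            simp only [e, ne_eq, Prod.mk.injEq, Fin.ext_iff, Bool.false_eq_true, if_true, if_false,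
              Fin.val_succ, Fin.val_castSucc] <;> omega
          simp [weightedMatrix, diagWeight, hp]
        · have hw : diagWeight (p.1, q.1) ≠ 0 := by
            have : (p.1 : ℕ) ≠ q.1 := fun h => hpq (Subtype.ext (Fin.ext h))
            simp only [diagWeight]
            exact pow_ne_zero _ (by omega)
          simp [weightedMatrix, Matrix.diagonal_apply_ne _ hpq, hw]
      rw [hdiag, Matrix.det_diagonal]
      exact Finset.prod_ne_zero_iff.mpr fun p _ => hy₀ _
    · have hR (a) (ha : a = i ∨ a = j) : ∃ s, a = R s := by
        rcases ha with rfl | rfl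
        · exact ⟨true, rfl⟩
        · exact ⟨false, rfl⟩
      intro a c ha hc
      obtain ⟨s, rfl⟩ := hR a ha
      obtain ⟨s', rfl⟩ := hR c hc
      rw [hdet, hI]
      exact h3 (s, s')

/-! ### Linear independence of diagonal-free monomials -/

/-- If the substitution `x_e = t ^ w_e * y_e` into `G` has order greater than the least weight `W` of
the monomials of `G`, and the constant terms of the `y_e` are independent variables off a set `C₀`
and vanish on it, then each monomial of weight `W` in `G` meets `C₀`. -/
lemma exists_mem_of_X_pow_dvd_eval₂ {τ K A : Type*} [CommRing K] [CommRing A]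
    {α : MvPolynomial τ K →+* A} (hα : Function.Injective α) (w : τ → ℕ)
    {C₀ : Set τ} {y : τ → PowerSeries A}
    (hy1 : ∀ e ∉ C₀, PowerSeries.constantCoeff (y e) = α (X e))
    (hy2 : ∀ e ∈ C₀, PowerSeries.constantCoeff (y e) = 0)
    {G : MvPolynomial τ K} {b₀ : τ →₀ ℕ} (hb₀ : b₀ ∈ G.support)
    (hmin : ∀ b ∈ G.support, Finsupp.weight w b₀ ≤ Finsupp.weight w b)
    (hφ : (PowerSeries.X : PowerSeries A) ^ (Finsupp.weight w b₀ + 1) ∣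
      eval₂ (PowerSeries.C.comp (α.comp C)) (fun e => PowerSeries.X ^ w e * y e) G) :
    ∃ e ∈ C₀, b₀ e ≠ 0 := by
  classical
  by_contra! hC₀
  let W := Finsupp.weight w b₀
  let z : τ → MvPolynomial τ K := fun e => if e ∈ C₀ then 0 else X e
  have hz (e) : PowerSeries.constantCoeff (y e) = α (z e) := by
    by_cases he : e ∈ C₀
    · simp [z, he, hy2 e he]
    · simp [z, he, hy1 e he]
  have hterm (b : τ →₀ ℕ) (c : K) :
      eval₂ (PowerSeries.C.comp (α.comp C)) (fun e => PowerSeries.X ^ w e * y e) (monomial b c) = PowerSeries.X ^ Finsupp.weight w b *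
        (PowerSeries.C (α (C c)) * b.prod fun e k => y e ^ k) := by
    simp only [eval₂_monomial, RingHom.comp_apply, mul_pow, Finsupp.prod_mul]
    have : (b.prod fun e k => ((PowerSeries.X : PowerSeries A) ^ w e) ^ k) =
        PowerSeries.X ^ Finsupp.weight w b := by
      simp only [Finsupp.weight_apply, Finsupp.sum, Finsupp.prod, ← pow_mul,
        Finset.prod_pow_eq_pow_sum, smul_eq_mul, mul_comm]
    rw [this]
    ring
  -- The part of `G` of weight `W` with the variables in `C₀` set to zero; its image under `α` is
  -- the coefficient of `X ^ W` in the substitution.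
  let H : MvPolynomial τ K := ∑ b ∈ G.support, if Finsupp.weight w b = W then
    C (coeff b G) * b.prod fun e k => z e ^ k else 0
  have hH : α H = 0 := by
    have h0 := PowerSeries.X_pow_dvd_iff.mp hφ W (Nat.lt_succ_self W)
    rw [G.as_sum, eval₂_sum, map_sum] at h0
    rw [← h0, map_sum]
    refine Finset.sum_congr rfl fun b hb => ?_
    rw [hterm, PowerSeries.coeff_X_pow_mul']
    have hWb : W ≤ Finsupp.weight w b := hmin b hb
    split_ifs with h1 h2 h2
    · rw [h1, Nat.sub_self, PowerSeries.coeff_zero_eq_constantCoeff_apply]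
      simp only [map_mul, PowerSeries.constantCoeff_C, Finsupp.prod, map_prod, map_pow, hz]
    · exact absurd h1.le h2
    · exact absurd (le_antisymm h2 hWb) h1
    · exact map_zero _
  have hH0 : H = 0 := hα (hH.trans (map_zero _).symm)
  have hcoeff : coeff b₀ H = coeff b₀ G := by
    simp only [H, coeff_sum]
    rw [Finset.sum_eq_single_of_mem b₀ hb₀]
    · rw [if_pos rfl]
      have : (b₀.prod fun e k => z e ^ k) = monomial b₀ 1 := by
        rw [monomial_eq, C_1, one_mul]
        refine Finsupp.prod_congr fun e he => ?_
        have : e ∉ C₀ := fun h => Finsupp.mem_support_iff.mp he (hC₀ e h)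
        simp [z, this]
      rw [this, C_mul_monomial, mul_one, coeff_monomial, if_pos rfl]
    · intro b _ hbne
      split_ifs with h
      · by_cases hbC : ∃ e ∈ b.support, e ∈ C₀
        · obtain ⟨e, heb, heC⟩ := hbC
          have : (b.prod fun e k => z e ^ k) = 0 := by
            refine Finset.prod_eq_zero heb ?_
            simp only [z, heC, if_true]
            exact zero_pow (Finsupp.mem_support_iff.mp heb)
          rw [this, mul_zero, coeff_zero]
        · push Not at hbC
          have : (b.prod fun e k => z e ^ k) = monomial b 1 := by
            rw [monomial_eq, C_1, one_mul]
            refine Finsupp.prod_congr fun e he => ?_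
            simp [z, hbC e he]
          rw [this, C_mul_monomial, mul_one, coeff_monomial, if_neg hbne]
      · exact coeff_zero _
  rw [hH0, coeff_zero] at hcoeff
  exact mem_support_iff.mp hb₀ hcoeff.symm

/-- The ideal of submaximal minors contains no nonzero combination of diagonal-free monomials. -/
lemma eq_zero_of_mem_minorsIdeal_of_diagFree {K : Type*} [Field K] {n : ℕ}
    {G : MvPolynomial (Fin (n + 1) × Fin (n + 1)) K}
    (hG : G ∈ minorsIdeal n (Matrix.mvPolynomialX (Fin (n + 1)) (Fin (n + 1)) K))
    (hGs : G ∈ restrictSupport K (diagFree (n + 1) n)) : G = 0 := by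
  classical
  by_contra hG0
  obtain ⟨b₀, hb₀, hmin⟩ := Finset.exists_min_image G.support (Finsupp.weight diagWeight)
    (support_nonempty.mpr hG0)
  obtain ⟨i, j, k, l, hik, hkj, hil, hlj, hi, hj, hk, hl⟩ :=
    exists_zeros_of_mem_diagFree ((mem_restrictSupport_iff ..).mp hGs hb₀)
  have hC₀ : ∀ e ∈ bandCover i j k l, b₀ e = 0 := by
    simp only [bandCover, Finset.mem_insert, Finset.mem_singleton]
    rintro e (rfl | rfl | rfl | rfl) <;> assumption
  -- In the fraction field the generic leading coefficients are invertible, as the lifting requires.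
  let α := algebraMap (MvPolynomial (Fin (n + 1) × Fin (n + 1)) K)
    (FractionRing (MvPolynomial (Fin (n + 1) × Fin (n + 1)) K))
  have hα : Function.Injective α := IsFractionRing.injective _ _
  obtain ⟨y, hy1, hy2, hy3⟩ := exists_lift_bandCover hik hkj hil hlj (fun e => α (X e))
    (fun e => by
      rw [Ne, map_eq_zero_iff _ hα]
      exact X_ne_zero e) (Finsupp.weight diagWeight b₀ + 1)
  obtain ⟨e, he, hne⟩ := exists_mem_of_X_pow_dvd_eval₂ hα diagWeight (C₀ := bandCover i j k l)
    (fun e he => by rw [hy1 e he, PowerSeries.constantCoeff_C]) hy2 hb₀ hmin (by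
      rw [← coe_eval₂Hom, ← Ideal.mem_span_singleton, ← Ideal.mem_comap]
      refine (Ideal.span_le.mpr ?_) hG
      rintro d ⟨f, g, rfl⟩
      rw [SetLike.mem_coe, Ideal.mem_comap, Ideal.mem_span_singleton, RingHom.map_det]
      convert hy3 f g using 2
      ext1 p q
      simp [weightedMatrix])
  exact hne (hC₀ e he)

/-! ### Regular sequences of variables from a monomial basis -/

section Regular

variable {τ K : Type*} [Field K] {I : Ideal (MvPolynomial τ K)} {B : Set (τ →₀ ℕ)} {E : Set τ}

lemma X_mul_mem_restrictSupport (hE : ∀ b ∈ B, ∀ e ∈ E, b + Finsupp.single e 1 ∈ B) {e : τ}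
    (he : e ∈ E) {F : MvPolynomial τ K} (hF : F ∈ restrictSupport K B) :
    F * X e ∈ restrictSupport K B := by
  classical
  rw [mem_restrictSupport_iff] at hF ⊢
  intro b hb
  rw [Finset.mem_coe, support_mul_X, Finset.mem_map] at hb
  obtain ⟨c, hc, rfl⟩ := hb
  exact hE c (hF hc) e he

/-- If the monomials with exponents in `B` form a basis modulo `I`, then adding variables that
preserve `B` to `I` creates only the obvious relations between these monomials. -/
lemma mem_span_X_of_mem_sup
    (hspan : ∀ F : MvPolynomial τ K, ∃ G ∈ restrictSupport K B, F - G ∈ I)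
    (hindep : ∀ G ∈ restrictSupport K B, G ∈ I → G = 0)
    (hE : ∀ b ∈ B, ∀ e ∈ E, b + Finsupp.single e 1 ∈ B) {S : Set τ} (hS : S ⊆ E)
    {F : MvPolynomial τ K} (hF : F ∈ restrictSupport K B) (hFI : F ∈ I ⊔ Ideal.span (X '' S)) :
    F ∈ Ideal.span (X '' S) := by
  -- Coefficients of the variables may be replaced by normal forms, because multiplication by these
  -- variables preserves `B`.
  have key : ∀ H ∈ Ideal.span (X '' S : Set (MvPolynomial τ K)),
      ∃ G ∈ restrictSupport K B, G ∈ Ideal.span (X '' S : Set (MvPolynomial τ K)) ∧ H - G ∈ I := by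
    intro H hH
    induction hH using Submodule.closure_induction with
    | zero => exact ⟨0, Submodule.zero_mem _, Submodule.zero_mem _, by simp⟩
    | add x y _ _ hx hy =>
      obtain ⟨G, hG, hGS, hGI⟩ := hx
      obtain ⟨G', hG', hGS', hGI'⟩ := hy
      refine ⟨G + G', Submodule.add_mem _ hG hG', Ideal.add_mem _ hGS hGS', ?_⟩
      rw [add_sub_add_comm]
      exact Ideal.add_mem _ hGI hGI'
    | smul_mem a x hx =>
      obtain ⟨e, he, rfl⟩ := hx
      obtain ⟨G, hG, hGI⟩ := hspan a
      refine ⟨G * X e, X_mul_mem_restrictSupport hE (hS he) hG,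
        Ideal.mul_mem_left _ _ (Ideal.subset_span ⟨e, he, rfl⟩), ?_⟩
      rw [smul_eq_mul, ← sub_mul]
      exact Ideal.mul_mem_right (X e) I hGI
  obtain ⟨P, hP, H, hH, rfl⟩ := Submodule.mem_sup.mp hFI
  obtain ⟨G, hG, hGS, hGI⟩ := key H hH
  have h0 := hindep (P + H - G) (Submodule.sub_mem _ hF hG) (by
    rw [add_sub_assoc]
    exact Ideal.add_mem _ hP hGI)
  rw [sub_eq_zero.mp h0]
  exact hGS

/-- Regularity is phrased with the submodules `J • ⊤` of the quotient; this moves it to sums of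
ideals in the ring itself. -/
lemma mk_mem_smul_top_iff {R : Type*} [CommRing R] {I J : Ideal R} {F : R} :
    Submodule.Quotient.mk F ∈ (J • ⊤ : Submodule R (R ⧸ I)) ↔ F ∈ I ⊔ J := by
  have h : (J • ⊤ : Submodule R (R ⧸ I)) = Submodule.map I.mkQ J := by
    conv_rhs => rw [← Ideal.mul_top J, ← smul_eq_mul, Submodule.map_smul'', Submodule.map_top,
      Submodule.range_mkQ]
  rw [h, ← Submodule.mkQ_apply, ← Submodule.mem_comap, Submodule.comap_map_mkQ]

/-- Variables that preserve the exponents of a monomial basis of the quotient by `I` form a regular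
sequence on this quotient, in any order. -/
lemma isRegular_map_X
    (hspan : ∀ F : MvPolynomial τ K, ∃ G ∈ restrictSupport K B, F - G ∈ I)
    (hindep : ∀ G ∈ restrictSupport K B, G ∈ I → G = 0)
    (hE : ∀ b ∈ B, ∀ e ∈ E, b + Finsupp.single e 1 ∈ B) (h0 : 0 ∈ B) {l : List τ} (hl : l.Nodup)
    (hlE : ∀ e ∈ l, e ∈ E) :
    RingTheory.Sequence.IsRegular (MvPolynomial τ K ⧸ I)
      (l.map (X : τ → MvPolynomial τ K)) := by
  have hofList (l : List τ) : Ideal.ofList (l.map X : List (MvPolynomial τ K)) =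
      Ideal.span ((X : τ → MvPolynomial τ K) '' {e | e ∈ l}) := by
    refine congrArg Ideal.span (Set.ext fun x => ?_)
    simp
  refine ⟨⟨fun i hi => ?_⟩, fun htop => ?_⟩
  · rw [List.length_map] at hi
    rw [isSMulRegular_quotient_iff_mem_of_smul_mem, ← List.map_take, hofList, List.getElem_map]
    intro x hx
    obtain ⟨F, rfl⟩ := Submodule.Quotient.mk_surjective _ x
    rw [← Submodule.Quotient.mk_smul, mk_mem_smul_top_iff, smul_eq_mul, mul_comm] at hx
    rw [mk_mem_smul_top_iff]
    have hmem : l[i] ∈ E := hlE _ (List.getElem_mem hi)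
    have hnot : l[i] ∉ l.take i := by
      intro h
      obtain ⟨j, hj, hij⟩ := List.getElem_of_mem h
      rw [List.length_take] at hj
      rw [List.getElem_take, hl.getElem_inj_iff] at hij
      omega
    obtain ⟨G, hG, hGI⟩ := hspan F
    have hGX : G * X l[i] ∈ Ideal.span (X '' {e | e ∈ l.take i}) := by
      refine mem_span_X_of_mem_sup hspan hindep hE (fun e he => hlE e (List.mem_of_mem_take he))
        (X_mul_mem_restrictSupport hE hmem hG) ?_
      have : G * X l[i] = F * X l[i] - (F - G) * X l[i] := by ring
      rw [this]
      exact Ideal.sub_mem _ hx (Ideal.mem_sup_left (Ideal.mul_mem_right _ _ hGI))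
    -- The ideal is monomial and its generators differ from `X l[i]`, so the factor `X l[i]` can be
    -- dropped from every monomial.
    have hGS : G ∈ Ideal.span (X '' {e | e ∈ l.take i}) := by
      rw [mem_ideal_span_X_image] at hGX ⊢
      intro b hb
      obtain ⟨e, he, hbe⟩ := hGX (b + Finsupp.single l[i] 1) (by
        rw [mem_support_iff, coeff_mul_X]
        exact mem_support_iff.mp hb)
      refine ⟨e, he, ?_⟩
      have hne : e ≠ l[i] := fun h => hnot (h ▸ he)
      simpa [Finsupp.single_apply, hne.symm] using hbe
    have : F = (F - G) + G := by ring
    rw [this]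
    exact Submodule.add_mem_sup hGI hGS
  · have h1 : (Submodule.Quotient.mk 1 : MvPolynomial τ K ⧸ I) ∈
        (Ideal.ofList (l.map X) • ⊤ : Submodule (MvPolynomial τ K) (MvPolynomial τ K ⧸ I)) :=
      htop ▸ Submodule.mem_top
    rw [mk_mem_smul_top_iff, hofList] at h1
    have h2 := mem_span_X_of_mem_sup (S := {e | e ∈ l}) hspan hindep hE (fun e he => hlE e he)
      ((monomial_mem_restrictSupport (m := 0) (r := (1 : K)) ..).mpr (Or.inl h0)) h1
    rw [mem_ideal_span_X_image] at h2
    obtain ⟨e, -, he⟩ := h2 0 (by simp)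
    exact he rfl

end Regular

/-! ### Passage from diagonals to anti-diagonals -/

/-- Conjugating an order embedding by the order reversals. -/
def revConj {r m : ℕ} (g : Fin r ↪o Fin m) : Fin r ↪o Fin m :=
  OrderEmbedding.ofStrictMono (fun p => (g p.rev).rev) fun a b hab => by
    rw [Fin.rev_lt_rev, g.lt_iff_lt, Fin.rev_lt_rev]
    exact hab

@[simp]
lemma revConj_apply {r m : ℕ} (g : Fin r ↪o Fin m) (p : Fin r) : revConj g p = (g p.rev).rev := rfl

/-- The reflection of the positions of a square matrix that reverses the columns. -/
def flipCols (m : ℕ) : Fin m × Fin m ≃ Fin m × Fin m := (Equiv.refl _).prodCongr Fin.revPerm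

@[simp]
lemma flipCols_apply {m : ℕ} (i j : Fin m) : flipCols m (i, j) = (i, j.rev) := rfl

@[simp]
lemma flipCols_flipCols {m : ℕ} (e : Fin m × Fin m) : flipCols m (flipCols m e) = e := by
  rcases e with ⟨i, j⟩
  simp

/-- Exponents of monomials divisible by the antidiagonal term of no `r`-minor. -/
def antidiagFree (m r : ℕ) : Set (Fin m × Fin m →₀ ℕ) :=
  {b | ∀ f g : Fin r ↪o Fin m, ∃ p, b (f p, g p.rev) = 0}

lemma mapDomain_flipCols_apply {m : ℕ} (b : Fin m × Fin m →₀ ℕ) (i j : Fin m) :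
    b.mapDomain (flipCols m) (i, j) = b (i, j.rev) := by
  conv_lhs => rw [← flipCols_flipCols (i, j), Finsupp.mapDomain_apply (flipCols m).injective]
  rfl

/-- Reversing columns carries the diagonal of the minor `(f, g)` to the anti-diagonal of `(f,
revConj g)`. -/
lemma mapDomain_flipCols_mem_diagFree {m r : ℕ} {b : Fin m × Fin m →₀ ℕ}
    (hb : b ∈ antidiagFree m r) : b.mapDomain (flipCols m) ∈ diagFree m r := by
  intro f g
  obtain ⟨p, hp⟩ := hb f (revConj g)
  refine ⟨p, ?_⟩
  rw [mapDomain_flipCols_apply]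
  simpa using hp

lemma mapDomain_flipCols_mem_antidiagFree {m r : ℕ} {b : Fin m × Fin m →₀ ℕ}
    (hb : b ∈ diagFree m r) : b.mapDomain (flipCols m) ∈ antidiagFree m r := by
  intro f g
  obtain ⟨p, hp⟩ := hb f (revConj g)
  refine ⟨p, ?_⟩
  rw [mapDomain_flipCols_apply]
  simpa using hp

lemma rename_mem_restrictSupport {τ υ K : Type*} [CommSemiring K] {s : Set (τ →₀ ℕ)}
    {t : Set (υ →₀ ℕ)} {φ : τ → υ} (hφ : Function.Injective φ) (h : ∀ b ∈ s, b.mapDomain φ ∈ t)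
    {F : MvPolynomial τ K} (hF : F ∈ restrictSupport K s) :
    rename φ F ∈ restrictSupport K t := by
  classical
  rw [mem_restrictSupport_iff] at hF ⊢
  rw [support_rename_of_injective hφ]
  intro b hb
  obtain ⟨c, hc, rfl⟩ := Finset.mem_image.mp hb
  exact h c (hF hc)

lemma rename_flipCols_mem_minorsIdeal {K : Type*} [Field K] {m r : ℕ}
    {F : MvPolynomial (Fin m × Fin m) K}
    (hF : F ∈ minorsIdeal r (Matrix.mvPolynomialX (Fin m) (Fin m) K)) :
    rename (flipCols m) F ∈ minorsIdeal r (Matrix.mvPolynomialX (Fin m) (Fin m) K) := by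
  change F ∈ Ideal.comap (rename (flipCols m)).toRingHom
    (minorsIdeal r (Matrix.mvPolynomialX (Fin m) (Fin m) K))
  refine (Ideal.span_le.mpr ?_) hF
  rintro d ⟨f, g, rfl⟩
  have h : ((rename (flipCols m)).toRingHom.mapMatrix
      ((Matrix.mvPolynomialX (Fin m) (Fin m) K).submatrix f g)) =
      ((Matrix.mvPolynomialX (Fin m) (Fin m) K).submatrix f (revConj g)).submatrix id
        Fin.revPerm := by
    ext1 p q
    simp
  rw [SetLike.mem_coe, Ideal.mem_comap, RingHom.map_det, h, Matrix.det_permute']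
  exact Ideal.mul_mem_left _ _ (Ideal.subset_span ⟨f, revConj g, rfl⟩)

lemma rename_flipCols_rename_flipCols {K : Type*} [Field K] {m : ℕ}
    (F : MvPolynomial (Fin m × Fin m) K) : rename (flipCols m) (rename (flipCols m) F) = F := by
  rw [rename_rename, show flipCols m ∘ flipCols m = id from funext flipCols_flipCols, rename_id_apply]

lemma exists_restrictSupport_antidiagFree (K : Type*) [Field K] (m r : ℕ)
    (F : MvPolynomial (Fin m × Fin m) K) :
    ∃ G ∈ restrictSupport K (antidiagFree m r),
      F - G ∈ minorsIdeal r (Matrix.mvPolynomialX (Fin m) (Fin m) K) := by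
  obtain ⟨G, hG, h⟩ := exists_restrictSupport_diagFree K m r (rename (flipCols m) F)
  refine ⟨rename (flipCols m) G, rename_mem_restrictSupport (flipCols m).injective
    (fun b => mapDomain_flipCols_mem_antidiagFree) hG, ?_⟩
  have h' := rename_flipCols_mem_minorsIdeal h
  rwa [map_sub, rename_flipCols_rename_flipCols] at h'

lemma eq_zero_of_mem_minorsIdeal_of_antidiagFree {K : Type*} [Field K] {n : ℕ}
    {G : MvPolynomial (Fin (n + 1) × Fin (n + 1)) K}
    (hGs : G ∈ restrictSupport K (antidiagFree (n + 1) n))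
    (hG : G ∈ minorsIdeal n (Matrix.mvPolynomialX (Fin (n + 1)) (Fin (n + 1)) K)) : G = 0 := by
  have h := eq_zero_of_mem_minorsIdeal_of_diagFree (rename_flipCols_mem_minorsIdeal hG)
    (rename_mem_restrictSupport (flipCols _).injective
      (fun b => mapDomain_flipCols_mem_diagFree) hGs)
  rw [← rename_flipCols_rename_flipCols G, h, map_zero]

/-! ### Positions off all anti-diagonals and their number -/

lemma le_val_orderEmbedding {r m : ℕ} (f : Fin r ↪o Fin m) (p : Fin r) : (p : ℕ) ≤ f p := by
  obtain ⟨k, hk⟩ := p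
  induction k with
  | zero => exact Nat.zero_le _
  | succ k ih =>
    have h1 := ih (by omega)
    have h2 : f ⟨k, by omega⟩ < f ⟨k + 1, hk⟩ := f.lt_iff_lt.mpr (by simp [Fin.lt_def])
    have h3 : (f ⟨k, by omega⟩ : ℕ) < f ⟨k + 1, hk⟩ := h2
    simp only at h1 ⊢
    omega

lemma val_orderEmbedding_le {n : ℕ} (f : Fin n ↪o Fin (n + 1)) (p : Fin n) :
    (f p : ℕ) ≤ p + 1 := by
  have h := le_val_orderEmbedding (revConj f) p.rev
  simp only [revConj_apply, Fin.rev_rev, Fin.val_rev] at h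
  have := p.isLt
  have := (f p).isLt
  omega

lemma mem_offAntidiagonals_iff {n : ℕ} (hn : 0 < n) (e : Fin (n + 1) × Fin (n + 1)) :
    e ∈ offAntidiagonals (n + 1) ↔ (e.1 + e.2 + 1 : ℕ) < n ∨ n + 1 < (e.1 + e.2 : ℕ) := by
  obtain ⟨i, j⟩ := e
  have hi := i.isLt
  have hj := j.isLt
  constructor
  · intro h
    have h' (a c : Fin (n + 1)) (p : Fin n) : (i, j) ≠ (a.succAbove p, c.succAbove p.rev) :=
      fun hp => h (Fin.succAboveOrderEmb a) (Fin.succAboveOrderEmb c) ⟨p, hp⟩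
    by_contra! hb
    obtain ⟨hb1, hb2⟩ := hb
    simp only at hb1 hb2
    -- On the band `n - 1 ≤ i + j ≤ n + 1`, deleting a suitable first or last row and column leaves
    -- a minor with `(i, j)` on its anti-diagonal.
    rcases (by omega : (i + j + 1 : ℕ) = n ∨ ((i + j : ℕ) = n ∧ (i : ℕ) < n) ∨
      ((i : ℕ) = n ∧ (j : ℕ) = 0) ∨ (i + j : ℕ) = n + 1) with hc | hc | hc | hc
    · refine h' (Fin.last n) (Fin.last n) ⟨i, by omega⟩ ?_
      simp only [Prod.mk.injEq, Fin.ext_iff, Fin.val_succAbove_eq_ite, Fin.val_rev, Fin.val_last]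
      constructor <;> (try split_ifs) <;> omega
    · refine h' (Fin.last n) 0 ⟨i, by omega⟩ ?_
      simp only [Prod.mk.injEq, Fin.ext_iff, Fin.val_succAbove_eq_ite, Fin.val_rev, Fin.val_last,
        Fin.val_zero, Nat.not_lt_zero, if_false]
      constructor <;> (try split_ifs) <;> omega
    · refine h' 0 (Fin.last n) ⟨n - 1, by omega⟩ ?_
      simp only [Prod.mk.injEq, Fin.ext_iff, Fin.val_succAbove_eq_ite, Fin.val_rev, Fin.val_last,
        Fin.val_zero, Nat.not_lt_zero, if_false]
      constructor <;> (try split_ifs) <;> omega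
    · refine h' 0 0 ⟨i - 1, by omega⟩ ?_
      simp only [Prod.mk.injEq, Fin.ext_iff, Fin.val_succAbove_eq_ite, Fin.val_rev, Fin.val_zero,
        Nat.not_lt_zero, if_false]
      constructor <;> omega
  · rintro h f g ⟨p, hp⟩
    obtain ⟨rfl, rfl⟩ := Prod.mk.inj hp
    have h1 := le_val_orderEmbedding f p
    have h2 := val_orderEmbedding_le f p
    have h3 := le_val_orderEmbedding g (p.rev : Fin n)
    have h4 := val_orderEmbedding_le g (p.rev : Fin n)
    have h5 : (p : ℕ) < n := p.isLt
    have h6 : (Fin.rev (n := n) p : ℕ) = n - (p + 1) := Fin.val_rev (n := n) p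
    simp only at h
    change (f p + g (Fin.rev (n := n) p) + 1 : ℕ) < n ∨
      n + 1 < (f p + g (Fin.rev (n := n) p) : ℕ) at h
    omega

lemma ncard_offAntidiagonals {n : ℕ} (hn : 0 < n) :
    (offAntidiagonals (n + 1)).ncard = n * (n - 1) := by
  -- After column reversal the set is the complement of the tridiagonal band; shifting its two
  -- triangles by one yields the off-diagonal of an `n × n` grid.
  let φ : Fin n × Fin n → Fin (n + 1) × Fin (n + 1) := fun a =>
    if a.1 < a.2 then (a.1.castSucc, a.2.succ.rev) else (a.1.succ, a.2.castSucc.rev)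
  have himage : offAntidiagonals (n + 1) =
      φ '' ((Finset.univ : Finset (Fin n)).offDiag : Set (Fin n × Fin n)) := by
    ext ⟨i, j⟩
    rw [mem_offAntidiagonals_iff hn]
    have hi := i.isLt
    have hj := j.isLt
    simp only [Set.mem_image, Finset.mem_coe, Finset.mem_offDiag, Finset.mem_univ, true_and,
      Prod.exists, φ]
    constructor
    · rintro (h | h)
      · refine ⟨⟨i, by omega⟩, ⟨n - 1 - j, by omega⟩, ?_, ?_⟩
        · simp only [ne_eq, Fin.mk.injEq]
          omega
        · rw [if_pos (by simp only [Fin.mk_lt_mk]; omega)]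
          simp only [Prod.mk.injEq, Fin.ext_iff, Fin.val_castSucc, Fin.val_rev, Fin.val_succ]
          exact ⟨trivial, by omega⟩
      · refine ⟨⟨i - 1, by omega⟩, ⟨n - j, by omega⟩, ?_, ?_⟩
        · simp only [ne_eq, Fin.mk.injEq]
          omega
        · rw [if_neg (by simp only [Fin.mk_lt_mk]; omega)]
          simp only [Prod.mk.injEq, Fin.ext_iff, Fin.val_castSucc, Fin.val_rev, Fin.val_succ]
          omega
    · rintro ⟨a, b, hab, h⟩
      have hab' : (a : ℕ) ≠ b := fun h => hab (Fin.ext h)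
      split_ifs at h with hlt <;>
      · simp only [Fin.lt_def] at hlt
        simp only [Prod.mk.injEq, Fin.ext_iff, Fin.val_castSucc, Fin.val_rev, Fin.val_succ] at h
        omega
  rw [himage, Set.InjOn.ncard_image, Set.ncard_coe_finset, Finset.offDiag_card]
  · simp [Nat.mul_sub]
  · rintro ⟨a, b⟩ hab ⟨c, d⟩ hcd h
    have hab' : (a : ℕ) ≠ b := fun h => (Finset.mem_offDiag.mp hab).2.2 (Fin.ext h)
    have hcd' : (c : ℕ) ≠ d := fun h => (Finset.mem_offDiag.mp hcd).2.2 (Fin.ext h)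
    simp only [φ] at h
    rw [Prod.mk.injEq, Fin.ext_iff, Fin.ext_iff]
    split_ifs at h with h1 h2 h2 <;>
    · simp only [Fin.lt_def] at h1 h2
      simp only [Prod.mk.injEq, Fin.ext_iff, Fin.val_castSucc, Fin.val_rev, Fin.val_succ] at h
      omega

theorem lemma3p4 (K : Type*) [Field K] (m : ℕ) (hm : 2 ≤ m) :
    (offAntidiagonals m).ncard = (m - 1) * (m - 2) ∧
    ∀ l : List (Fin m × Fin m), l.Nodup → (∀ e, e ∈ l ↔ e ∈ offAntidiagonals m) →
      RingTheory.Sequence.IsRegular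
        (MvPolynomial (Fin m × Fin m) K ⧸
          minorsIdeal (m - 1) (Matrix.mvPolynomialX (Fin m) (Fin m) K))
        (l.map fun e => Matrix.mvPolynomialX (Fin m) (Fin m) K e.1 e.2) := by
  obtain ⟨n, rfl⟩ : ∃ n, m = n + 1 := ⟨m - 1, by omega⟩
  have hn : 0 < n := by omega
  refine ⟨ncard_offAntidiagonals hn, fun l hl hmem => ?_⟩
  refine isRegular_map_X (B := antidiagFree (n + 1) n) (E := offAntidiagonals (n + 1))
    (exists_restrictSupport_antidiagFree K (n + 1) n)
    (fun G => eq_zero_of_mem_minorsIdeal_of_antidiagFree) ?_ ?_ hl fun e he => (hmem e).mp he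
  -- The position `e` is on no anti-diagonal, so the zero exponent of `b` found there remains zero.
  · intro b hb e he f g
    obtain ⟨p, hp⟩ := hb f g
    refine ⟨p, ?_⟩
    have hne : e ≠ (f p, g p.rev) := fun h => he f g ⟨p, h⟩
    simp [hp, hne]
  -- Here `0 < n` is needed: a minor of size `0` equals `1`.
  · exact fun f g => ⟨⟨0, hn⟩, rfl⟩
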